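/- **Setting.** Let $\mathcal H$ and $\mathfrak h$ be complex Hilbert spaces, with scalar products conjugate-linear in the first variable. Let $A:D(A)\subseteq\mathcal H\to\mathcal H$ be self-adjoint. Let $\mathcal H_+$ be $D(A)$ with the graph scalar product $\langle\phi_1,\phi_2\rangle_+=\langle\phi_1,\phi_2\rangle+\langle A\phi_1,A\phi_2\rangle$, and let $\mathcal H_-$ be the completion of $\mathcal H$ with respect to $\langle\phi_1,\phi_2\rangle_-=\langle(A^2+1)^{-1/2}\phi_1,(A^2+1)^{-1/2}\phi_2\rangle$. Let $I_-:\mathcal H\to\mathcal H_-$ be the canonical embedding. The scalar product of $\mathcal H$ extends by continuity to a pairing $(\cdot,\cdot):\mathcal H_-\times\mathcal H_+\to\mathbb C$, $(I_-\phi_1,\phi_2)=\langle\phi_1,\phi_2\rangle$, and $\varphi\mapsto(\varphi,\cdot)$ is a conjugate-linear isometric isomorphism of $\mathcal H_-$ onto the dual $\mathcal H_+'$. Let $\bar A:\mathcal H\to\mathcal H_-$ be the unique bounded extension of $I_-A:D(A)\subseteq\mathcal H\to\mathcal H_-$. Let $\tau:\mathcal H_+\to\mathfrak h$ be bounded, linear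 and surjective, with $\mathcal N:=\mathrm{Kernel}\,\tau$ dense in $\mathcal H$, and let $\tau^*:\mathfrak h\to\mathcal H_-$ be the bounded operator with $(\tau^*Q,\phi)=\langle Q,\tau\phi\rangle_{\mathfrak h}$ for all $\phi\in\mathcal H_+$. For $z\in\mathbb C\setminus\mathbb R$ put $R(z)=(-A+z)^{-1}:\mathcal H\to\mathcal H_+$ and $G(z)=(\tau R(\bar z))^*:\mathfrak h\to\mathcal H$. Fix $z_0\in\mathbb C\setminus\mathbb R$ and put $$G_\star=\tfrac12\,(G(z_0)+G(\bar z_0)),\qquad G_\diamond=\tfrac12\,(G(z_0)-G(\bar z_0)).$$ Let $$D(\widetilde A)=\{\phi\in\mathcal H:\ \phi=\phi_0+G_\star Q_\phi,\ \phi_0\in D(A),\ Q_\phi\in\mathfrak h\};$$ here $\phi_0$ and $Q_\phi$ are uniquely determined by $\phi$. Define $T,\widetilde A:D(\widetilde A)\to\mathcal H_-$ by $T\phi=\tau^*Q_\phi$ and $\widetilde A=\bar A+T$. For a self-adjoint operator $\Theta:D(\Theta)\subseteq\mathfrak h\to\mathfrak h$ let $$D(A_\Theta)=\{\phi\in\mathcal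 H:\ \phi=\phi_0+G_\star Q_\phi,\ \phi_0\in D(A),\ Q_\phi\in D(\Theta),\ \tau\phi_0=\Theta Q_\phi\},$$ $$A_\Theta\phi=A\phi_0+\mathrm{Re}(z_0)\,G_\star Q_\phi+i\,\mathrm{Im}(z_0)\,G_\diamond Q_\phi ,\qquad T_\Theta=T|_{D(A_\Theta)}.$$ **Theorem 3.4.** The operator $\widetilde A$ is $\mathcal H$-valued, that is, its range is contained in $I_-(\mathcal H)$. For every self-adjoint operator $\Theta$ in $\mathfrak h$ the following holds. 1. $A_\Theta$ is a self-adjoint operator in $\mathcal H$ that extends the restriction of $A$ to $\mathcal N$. 2. An element $\phi\in D(\widetilde A)$ lies in $D(A_\Theta)$ if and only if $Q_\phi\in D(\Theta)$ and $\tau\phi_0=\Theta Q_\phi$, and the restriction of $\widetilde A$ to $D(A_\Theta)$ coincides with $A_\Theta$ (with $\mathcal H$ regarded as a subspace of $\mathcal H_-$ through $I_-$). 3. Consequently $A_\Theta=\bar A+T_\Theta$ on $D(A_\Theta)$, as $\mathcal H_-$-valued operators. 4. If $\Theta$ has a bounded, everywhere defined inverse $\Theta^{-1}$, then there is a bounded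 linear operator $V_\Theta:\mathcal H_+\to\mathcal H_-$ with $(V_\Theta\phi_1,\phi_2)=\langle\Theta^{-1}\tau\phi_1,\tau\phi_2\rangle_{\mathfrak h}$ for all $\phi_1,\phi_2\in\mathcal H_+$, and $A_\Theta\phi=\bar A\phi+V_\Theta\phi_0$ for all $\phi\in D(A_\Theta)$. -/

import Mathlib

open scoped ComplexConjugate InnerProductSpace

noncomputable section

namespace AddPert

variable {H : Type*} [NormedAddCommGroup H] [InnerProductSpace ℂ H]

/-! ### The space `H₊`: the domain of `A` with the graph inner product -/

/-- The space `H₊`: the operator domain `D(A)`, to be equipped with the graph inner product. -/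
def HPlus (A : H →ₗ.[ℂ] H) : Type _ := A.domain

instance (A : H →ₗ.[ℂ] H) : AddCommGroup (HPlus A) := inferInstanceAs (AddCommGroup A.domain)

instance (A : H →ₗ.[ℂ] H) : Module ℂ (HPlus A) := inferInstanceAs (Module ℂ A.domain)

/-- The inclusion `D(A) → H` as a linear map on `H₊`. -/
def inclₗ (A : H →ₗ.[ℂ] H) : HPlus A →ₗ[ℂ] H := A.domain.subtype

/-- The operator `A` as a linear map on `H₊`. -/
def opₗ (A : H →ₗ.[ℂ] H) : HPlus A →ₗ[ℂ] H := A.toFun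

theorem inclₗ_injective (A : H →ₗ.[ℂ] H) : Function.Injective (inclₗ A) :=
  Subtype.val_injective

/-- The graph inner product `⟨φ₁, φ₂⟩₊ = ⟨φ₁, φ₂⟩ + ⟨A φ₁, A φ₂⟩`, which for a self-adjoint `A` is
`⟨(A² + 1)^{1/2} φ₁, (A² + 1)^{1/2} φ₂⟩`. -/
@[reducible]
def hPlusCore (A : H →ₗ.[ℂ] H) : InnerProductSpace.Core ℂ (HPlus A) where
  inner φ ψ := ⟪inclₗ A φ, inclₗ A ψ⟫_ℂ + ⟪opₗ A φ, opₗ A ψ⟫_ℂ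
  conj_inner_symm φ ψ := by simp
  re_inner_nonneg φ := by
    have h1 := inner_self_nonneg (𝕜 := ℂ) (x := inclₗ A φ)
    have h2 := inner_self_nonneg (𝕜 := ℂ) (x := opₗ A φ)
    simpa using add_nonneg h1 h2
  add_left φ ψ χ := by simp only [map_add, inner_add_left]; ring
  smul_left φ ψ r := by simp only [map_smul, inner_smul_left]; ring
  definite φ h := by
    rw [inner_self_eq_norm_sq_to_K, inner_self_eq_norm_sq_to_K] at h
    have h1 : ‖inclₗ A φ‖ ^ 2 + ‖opₗ A φ‖ ^ 2 = 0 := by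
      have h' := congrArg Complex.re h
      simpa [← Complex.ofReal_pow] using h'
    have h2 : ‖inclₗ A φ‖ = 0 := by
      nlinarith [sq_nonneg ‖inclₗ A φ‖, sq_nonneg ‖opₗ A φ‖]
    exact inclₗ_injective A (by rw [norm_eq_zero.mp h2, map_zero])

instance (A : H →ₗ.[ℂ] H) : NormedAddCommGroup (HPlus A) :=
  @InnerProductSpace.Core.toNormedAddCommGroup ℂ (HPlus A) _ _ _ (hPlusCore A)

instance (A : H →ₗ.[ℂ] H) : InnerProductSpace ℂ (HPlus A) :=
  InnerProductSpace.ofCore (hPlusCore A).toCore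

theorem hPlus_inner (A : H →ₗ.[ℂ] H) (φ ψ : HPlus A) :
    ⟪φ, ψ⟫_ℂ = ⟪inclₗ A φ, inclₗ A ψ⟫_ℂ + ⟪opₗ A φ, opₗ A ψ⟫_ℂ := rfl

theorem hPlus_norm_sq (A : H →ₗ.[ℂ] H) (φ : HPlus A) :
    ‖φ‖ ^ 2 = ‖inclₗ A φ‖ ^ 2 + ‖opₗ A φ‖ ^ 2 := by
  have h := hPlus_inner A φ φ
  simp only [inner_self_eq_norm_sq_to_K] at h
  exact_mod_cast h

/-- The inclusion `H₊ → H`. -/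
def incl (A : H →ₗ.[ℂ] H) : HPlus A →L[ℂ] H :=
  (inclₗ A).mkContinuous 1 fun φ => by
    have h := hPlus_norm_sq A φ
    rw [one_mul]
    exact abs_le_of_sq_le_sq' (by nlinarith [sq_nonneg ‖opₗ A φ‖]) (norm_nonneg _) |>.2

/-- `A` as a bounded operator from `H₊` to `H`. -/
def op (A : H →ₗ.[ℂ] H) : HPlus A →L[ℂ] H :=
  (opₗ A).mkContinuous 1 fun φ => by
    have h := hPlus_norm_sq A φ
    rw [one_mul]
    exact abs_le_of_sq_le_sq' (by nlinarith [sq_nonneg ‖inclₗ A φ‖]) (norm_nonneg _) |>.2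

theorem incl_injective (A : H →ₗ.[ℂ] H) : Function.Injective (incl A) :=
  Subtype.val_injective

theorem norm_incl_le (A : H →ₗ.[ℂ] H) (φ : HPlus A) : ‖incl A φ‖ ≤ ‖φ‖ := by
  have h := hPlus_norm_sq A φ
  exact abs_le_of_sq_le_sq' (by change ‖inclₗ A φ‖ ^ 2 ≤ _; nlinarith [sq_nonneg ‖opₗ A φ‖])
    (norm_nonneg _) |>.2

variable {A : H →ₗ.[ℂ] H}

/-- The subspace `N = Kernel τ` of `D(A)`, as a subspace of `H`. -/
def kerN {𝔥 : Type*} [NormedAddCommGroup 𝔥] [InnerProductSpace ℂ 𝔥] (τ : HPlus A →L[ℂ] 𝔥) :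
    Submodule ℂ H :=
  (LinearMap.ker τ.toLinearMap).map (inclₗ A)

/-! ### The resolvent -/

/-- The operator `-A + z`, bounded from `H₊` to `H`. -/
def shift (A : H →ₗ.[ℂ] H) (z : ℂ) : HPlus A →L[ℂ] H := z • incl A - op A

theorem shift_apply (A : H →ₗ.[ℂ] H) (z : ℂ) (φ : HPlus A) :
    shift A z φ = z • incl A φ - op A φ := rfl

variable [CompleteSpace H]

theorem op_symm (hA : IsSelfAdjoint A) (φ ψ : HPlus A) :
    ⟪op A φ, incl A ψ⟫_ℂ = ⟪incl A φ, op A ψ⟫_ℂ := by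
  have h := LinearPMap.adjoint_isFormalAdjoint hA.dense_domain
  rw [LinearPMap.isSelfAdjoint_def.mp hA] at h
  exact h φ ψ

theorem incl_denseRange (hA : IsSelfAdjoint A) : DenseRange (incl A) :=
  hA.dense_domain.denseRange_val

theorem exists_hPlus (hA : IsSelfAdjoint A) (x y : H)
    (h : ∀ φ : HPlus A, ⟪y, incl A φ⟫_ℂ = ⟪x, op A φ⟫_ℂ) :
    ∃ ψ : HPlus A, incl A ψ = x ∧ op A ψ = y := by
  have hx : x ∈ A.domain := by
    rw [← LinearPMap.isSelfAdjoint_def.mp hA]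
    exact LinearPMap.mem_adjoint_domain_of_exists x ⟨y, fun φ => h φ⟩
  refine ⟨(⟨x, hx⟩ : A.domain), rfl, ?_⟩
  refine hA.dense_domain.eq_of_inner_left ℂ fun v hv => ?_
  exact (op_symm hA (⟨x, hx⟩ : A.domain) (⟨v, hv⟩ : A.domain)).trans
    (h (⟨v, hv⟩ : A.domain)).symm

theorem inner_shift_left (hA : IsSelfAdjoint A) (z : ℂ) (φ ψ : HPlus A) :
    ⟪shift A z φ, incl A ψ⟫_ℂ = ⟪incl A φ, shift A (conj z) ψ⟫_ℂ := by
  simp only [shift_apply, inner_sub_left, inner_sub_right, inner_smul_left, inner_smul_right,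
    op_symm hA]

theorem im_mul_norm_le (hA : IsSelfAdjoint A) (z : ℂ) (φ : HPlus A) :
    |z.im| * ‖incl A φ‖ ≤ ‖shift A z φ‖ := by
  have h1 : (⟪incl A φ, op A φ⟫_ℂ).im = 0 := by
    rw [← Complex.conj_eq_iff_im, inner_conj_symm, op_symm hA]
  have h2 : (⟪incl A φ, shift A z φ⟫_ℂ).im = z.im * ‖incl A φ‖ ^ 2 := by
    rw [shift_apply, inner_sub_right, inner_smul_right, inner_self_eq_norm_sq_to_K,
      Complex.sub_im, h1, sub_zero]
    simp [← Complex.ofReal_pow]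
  have h3 : |z.im| * ‖incl A φ‖ ^ 2 ≤ ‖incl A φ‖ * ‖shift A z φ‖ := by
    calc |z.im| * ‖incl A φ‖ ^ 2 = |(⟪incl A φ, shift A z φ⟫_ℂ).im| := by
          rw [h2, abs_mul, abs_of_nonneg (sq_nonneg ‖incl A φ‖)]
      _ ≤ ‖⟪incl A φ, shift A z φ⟫_ℂ‖ := Complex.abs_im_le_norm _
      _ ≤ _ := norm_inner_le_norm _ _
  rcases (norm_nonneg (incl A φ)).eq_or_lt with h | h
  · rw [← h, mul_zero]
    exact norm_nonneg _
  · exact le_of_mul_le_mul_left (by linarith [h3]) h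

theorem shift_injective (hA : IsSelfAdjoint A) {z : ℂ} (hz : z.im ≠ 0) :
    Function.Injective (shift A z) := by
  refine (injective_iff_map_eq_zero _).mpr fun φ h => ?_
  have h1 := im_mul_norm_le hA z φ
  rw [h, norm_zero] at h1
  have h2 : ‖incl A φ‖ = 0 :=
    le_antisymm (by by_contra! h3; nlinarith [mul_pos (abs_pos.mpr hz) h3]) (norm_nonneg _)
  exact incl_injective A (by rw [norm_eq_zero.mp h2, map_zero])

theorem hPlus_complete (hA : IsSelfAdjoint A) : CompleteSpace (HPlus A) := by
  let g : HPlus A →L[ℂ] H × H := (incl A).prod (op A)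
  have hg : AntilipschitzWith 2 g := by
    refine ContinuousLinearMap.antilipschitz_of_bound _ fun φ => ?_
    have h := hPlus_norm_sq A φ
    have h1 : ‖inclₗ A φ‖ ≤ ‖g φ‖ := norm_fst_le (g φ)
    have h2 : ‖opₗ A φ‖ ≤ ‖g φ‖ := norm_snd_le (g φ)
    refine abs_le_of_sq_le_sq' ?_ (by positivity) |>.2
    have h3 := pow_le_pow_left₀ (norm_nonneg _) h1 2
    have h4 := pow_le_pow_left₀ (norm_nonneg _) h2 2
    rw [h, mul_pow]
    norm_num
    nlinarith [sq_nonneg ‖g φ‖]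
  refine (hg.isUniformInducing g.uniformContinuous).completeSpace ?_
  have hr : Set.range g = (A.graph : Set (H × H)) := by
    ext x
    constructor
    · rintro ⟨φ, rfl⟩
      exact (LinearPMap.mem_graph_iff A).mpr ⟨φ, rfl, rfl⟩
    · intro hx
      obtain ⟨φ, h1, h2⟩ := (LinearPMap.mem_graph_iff A).mp hx
      exact ⟨φ, Prod.ext h1 h2⟩
  rw [hr]
  exact (show IsClosed (A.graph : Set (H × H)) from hA.isClosed).isComplete

theorem shift_surjective (hA : IsSelfAdjoint A) {z : ℂ} (hz : z.im ≠ 0) :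
    Function.Surjective (shift A z) := by
  have := hPlus_complete hA
  have hb : 0 < |z.im| := abs_pos.mpr hz
  have hanti : AntilipschitzWith (Real.toNNReal (1 + (1 + ‖z‖) / |z.im|)) (shift A z) := by
    refine ContinuousLinearMap.antilipschitz_of_bound _ fun φ => ?_
    have h1 := im_mul_norm_le hA z φ
    have h2 : ‖op A φ‖ ≤ ‖z‖ * ‖incl A φ‖ + ‖shift A z φ‖ := by
      have : op A φ = z • incl A φ - shift A z φ := by rw [shift_apply]; abel
      rw [this, ← norm_smul]
      exact norm_sub_le _ _
    have h3 : ‖φ‖ ≤ ‖incl A φ‖ + ‖op A φ‖ := by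
      have h := hPlus_norm_sq A φ
      refine abs_le_of_sq_le_sq' ?_ (by positivity) |>.2
      change _ ≤ (‖inclₗ A φ‖ + ‖opₗ A φ‖) ^ 2
      nlinarith [mul_nonneg (norm_nonneg (inclₗ A φ)) (norm_nonneg (opₗ A φ))]
    have h4 : ‖incl A φ‖ ≤ ‖shift A z φ‖ / |z.im| := by
      rw [le_div_iff₀ hb]; linarith
    rw [Real.coe_toNNReal _ (by positivity)]
    calc ‖φ‖ ≤ ‖shift A z φ‖ + (1 + ‖z‖) * ‖incl A φ‖ := by linarith
      _ ≤ ‖shift A z φ‖ + (1 + ‖z‖) * (‖shift A z φ‖ / |z.im|) := by gcongr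
      _ = _ := by ring
  have hclosed : IsClosed ((LinearMap.range (shift A z).toLinearMap : Submodule ℂ H) : Set H) :=
    hanti.isClosed_range (shift A z).uniformContinuous
  have : CompleteSpace (LinearMap.range (shift A z).toLinearMap : Submodule ℂ H) :=
    hclosed.completeSpace_coe
  have hperp : (LinearMap.range (shift A z).toLinearMap : Submodule ℂ H)ᗮ = ⊥ := by
    rw [Submodule.eq_bot_iff]
    intro y hy
    have h1 : ∀ φ : HPlus A, ⟪conj z • y, incl A φ⟫_ℂ = ⟪y, op A φ⟫_ℂ := fun φ => by
      have h2 := (Submodule.mem_orthogonal' _ y).mp hy (shift A z φ) ⟨φ, rfl⟩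
      rw [shift_apply, inner_sub_right, inner_smul_right, sub_eq_zero] at h2
      rw [inner_smul_left, Complex.conj_conj, h2]
    obtain ⟨ψ, h3, h4⟩ := exists_hPlus hA y _ h1
    have h5 : shift A (conj z) ψ = 0 := by rw [shift_apply, h3, h4, sub_self]
    have h6 : ψ = 0 := shift_injective hA (z := conj z) (by simpa using hz) (by rw [h5, map_zero])
    rw [← h3, h6, map_zero]
  exact LinearMap.range_eq_top.mp (Submodule.orthogonal_eq_bot_iff.mp hperp)

/-- For non-real `z`, the operator `-A + z` as a topological isomorphism from `H₊` onto `H`. -/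
def shiftEquiv (hA : IsSelfAdjoint A) {z : ℂ} (hz : z.im ≠ 0) : HPlus A ≃L[ℂ] H :=
  haveI := hPlus_complete hA
  ContinuousLinearEquiv.ofBijective (shift A z)
    (LinearMap.ker_eq_bot.mpr (shift_injective hA hz))
    (LinearMap.range_eq_top.mpr (shift_surjective hA hz))

/-- The resolvent `R(z) = (-A + z)⁻¹ : H → H₊` at a non-real `z`. -/
def resolvent (hA : IsSelfAdjoint A) {z : ℂ} (hz : z.im ≠ 0) : H →L[ℂ] HPlus A :=
  (shiftEquiv hA hz).symm

theorem shift_resolvent (hA : IsSelfAdjoint A) {z : ℂ} (hz : z.im ≠ 0) (x : H) :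
    shift A z (resolvent hA hz x) = x :=
  (shiftEquiv hA hz).apply_symm_apply x

theorem resolvent_shift (hA : IsSelfAdjoint A) {z : ℂ} (hz : z.im ≠ 0) (φ : HPlus A) :
    resolvent hA hz (shift A z φ) = φ :=
  (shiftEquiv hA hz).symm_apply_apply φ

theorem I_im_ne : Complex.I.im ≠ 0 := by simp

theorem conj_im_ne {z : ℂ} (hz : z.im ≠ 0) : (conj z).im ≠ 0 := by simpa using hz

theorem inner_shift_shift (hA : IsSelfAdjoint A) {z : ℂ} (h1 : conj z = -z) (h2 : z * z = -1)
    (φ ψ : HPlus A) : ⟪shift A z φ, shift A z ψ⟫_ℂ = ⟪φ, ψ⟫_ℂ := by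
  rw [hPlus_inner]
  change _ = ⟪incl A φ, incl A ψ⟫_ℂ + ⟪op A φ, op A ψ⟫_ℂ
  simp only [shift_apply, inner_sub_left, inner_sub_right, inner_smul_left, inner_smul_right,
    op_symm hA, h1]
  linear_combination (-⟪incl A φ, incl A ψ⟫_ℂ) * h2

theorem norm_shift (hA : IsSelfAdjoint A) {z : ℂ} (h1 : conj z = -z) (h2 : z * z = -1)
    (φ : HPlus A) : ‖shift A z φ‖ = ‖φ‖ := by
  have h := inner_shift_shift hA h1 h2 φ φ
  rw [inner_self_eq_norm_sq_to_K, inner_self_eq_norm_sq_to_K] at h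
  have h' : ‖shift A z φ‖ ^ 2 = ‖φ‖ ^ 2 := by exact_mod_cast h
  exact (sq_eq_sq₀ (norm_nonneg _) (norm_nonneg _)).mp h'

theorem norm_shift_I (hA : IsSelfAdjoint A) (φ : HPlus A) :
    ‖shift A Complex.I φ‖ = ‖φ‖ := norm_shift hA (by simp) (by simp) φ

theorem norm_shift_conj_I (hA : IsSelfAdjoint A) (φ : HPlus A) :
    ‖shift A (conj Complex.I) φ‖ = ‖φ‖ := norm_shift hA (by simp) (by simp) φ

/-! ### The space `H₋` -/

/-- The pre-Hilbert space given by the set `H`, to be equipped with the scalar product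
`⟨φ₁, φ₂⟩₋ = ⟨(A² + 1)^{-1/2} φ₁, (A² + 1)^{-1/2} φ₂⟩`. -/
def HMinusPre (_hA : IsSelfAdjoint A) : Type _ := H

instance (hA : IsSelfAdjoint A) : AddCommGroup (HMinusPre hA) := inferInstanceAs (AddCommGroup H)

instance (hA : IsSelfAdjoint A) : Module ℂ (HMinusPre hA) := inferInstanceAs (Module ℂ H)

/-- The operator `(-A + i)⁻¹`, as a linear map from `H` to `H`. -/
def resI (hA : IsSelfAdjoint A) : HMinusPre hA →ₗ[ℂ] H :=
  ((incl A).comp (resolvent hA I_im_ne)).toLinearMap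

theorem resI_injective (hA : IsSelfAdjoint A) : Function.Injective (resI hA) :=
  (incl_injective A).comp (shiftEquiv hA I_im_ne).symm.injective

/-- The scalar product `⟨φ₁, φ₂⟩₋ = ⟨(A² + 1)⁻¹ φ₁, φ₂⟩ = ⟨R(i) φ₁, R(i) φ₂⟩`, where the second
equality holds because `(A² + 1)⁻¹ = R(i)* R(i)`. -/
@[reducible]
def hMinusCore (hA : IsSelfAdjoint A) : InnerProductSpace.Core ℂ (HMinusPre hA) where
  inner φ ψ := ⟪resI hA φ, resI hA ψ⟫_ℂ
  conj_inner_symm φ ψ := by simp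
  re_inner_nonneg φ := inner_self_nonneg (𝕜 := ℂ) (x := resI hA φ)
  add_left φ ψ χ := by simp only [map_add, inner_add_left]
  smul_left φ ψ r := by simp only [map_smul, inner_smul_left]
  definite φ h := resI_injective hA (by rw [inner_self_eq_zero.mp h, map_zero])

instance (hA : IsSelfAdjoint A) : NormedAddCommGroup (HMinusPre hA) :=
  @InnerProductSpace.Core.toNormedAddCommGroup ℂ (HMinusPre hA) _ _ _ (hMinusCore hA)

instance (hA : IsSelfAdjoint A) : InnerProductSpace ℂ (HMinusPre hA) :=
  InnerProductSpace.ofCore (hMinusCore hA).toCore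

theorem hMinus_norm (hA : IsSelfAdjoint A) (φ : HMinusPre hA) : ‖φ‖ = ‖resI hA φ‖ := by
  have h : ⟪φ, φ⟫_ℂ = ⟪resI hA φ, resI hA φ⟫_ℂ := rfl
  rw [inner_self_eq_norm_sq_to_K, inner_self_eq_norm_sq_to_K] at h
  have h' : ‖φ‖ ^ 2 = ‖resI hA φ‖ ^ 2 := by exact_mod_cast h
  exact (sq_eq_sq₀ (norm_nonneg _) (norm_nonneg _)).mp h'

/-- The Hilbert space `H₋`, the completion of `H` with respect to `⟨·, ·⟩₋`. -/
abbrev HMinus (hA : IsSelfAdjoint A) : Type _ := UniformSpace.Completion (HMinusPre hA)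

/-- The identity of `H` as a linear map onto the pre-Hilbert space. -/
def toPre (hA : IsSelfAdjoint A) : H →ₗ[ℂ] HMinusPre hA := LinearMap.id

/-- The canonical embedding `I₋ : H → H₋`. -/
def embMinus (hA : IsSelfAdjoint A) : H →L[ℂ] HMinus hA :=
  UniformSpace.Completion.toComplL.comp
    ((toPre hA).mkContinuous ‖(incl A).comp (resolvent hA I_im_ne)‖ fun φ => by
      rw [hMinus_norm]
      exact ((incl A).comp (resolvent hA I_im_ne)).le_opNorm φ)

/-- `I₋` as a linear map. -/
abbrev embMinusₗ (hA : IsSelfAdjoint A) : H →ₗ[ℂ] HMinus hA :=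
  (embMinus hA : H →L[ℂ] HMinus hA)

theorem norm_embMinus (hA : IsSelfAdjoint A) (φ : H) :
    ‖embMinus hA φ‖ = ‖incl A (resolvent hA I_im_ne φ)‖ :=
  (UniformSpace.Completion.norm_coe (toPre hA φ)).trans (hMinus_norm hA _)

theorem embMinus_denseRange (hA : IsSelfAdjoint A) : DenseRange (embMinus hA) :=
  (UniformSpace.Completion.denseRange_coe :
    DenseRange ((↑) : HMinusPre hA → UniformSpace.Completion (HMinusPre hA)))

/-- The canonical embedding `I₊ : H' → H₊'`, `(I₊ λ)(φ) = ⟨C⁻¹ λ, φ⟩ = λ(φ)` for `φ ∈ D(A)`. -/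
def embDual (A : H →ₗ.[ℂ] H) : StrongDual ℂ H →L[ℂ] StrongDual ℂ (HPlus A) :=
  ContinuousLinearMap.precomp ℂ (incl A)

/-- `I₊` as a linear map. -/
abbrev embDualₗ (A : H →ₗ.[ℂ] H) : StrongDual ℂ H →ₗ[ℂ] StrongDual ℂ (HPlus A) :=
  (embDual A : StrongDual ℂ H →L[ℂ] StrongDual ℂ (HPlus A))

theorem embDual_denseRange (hA : IsSelfAdjoint A) : DenseRange (embDual A) := by
  have := hPlus_complete hA
  let J : H → StrongDual ℂ (HPlus A) := fun v => (InnerProductSpace.toDual ℂ H v).comp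
    (shift A Complex.I)
  have hJc : Continuous J :=
    (ContinuousLinearMap.precomp ℂ (shift A Complex.I)).continuous.comp
      (InnerProductSpace.toDual ℂ H).continuous
  have hJs : Function.Surjective J := fun l => by
    refine ⟨shift A Complex.I ((InnerProductSpace.toDual ℂ (HPlus A)).symm l), ?_⟩
    ext ψ
    change ⟪shift A Complex.I _, shift A Complex.I ψ⟫_ℂ = _
    rw [inner_shift_shift hA (by simp) (by simp), InnerProductSpace.toDual_symm_apply]
  refine (hJs.denseRange.comp (incl_denseRange hA) hJc).mono ?_
  rintro _ ⟨u, rfl⟩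
  refine ⟨InnerProductSpace.toDual ℂ H (shift A (conj Complex.I) u), ?_⟩
  ext ψ
  change ⟪shift A (conj Complex.I) u, incl A ψ⟫_ℂ = ⟪incl A u, shift A Complex.I ψ⟫_ℂ
  rw [inner_shift_left hA, Complex.conj_conj]

theorem norm_embDual_toDual (hA : IsSelfAdjoint A) (φ : H) :
    ‖embDual A (InnerProductSpace.toDual ℂ H φ)‖ = ‖embMinus hA φ‖ := by
  rw [norm_embMinus]
  set u := resolvent hA I_im_ne φ with hu
  have hφ : shift A Complex.I u = φ := shift_resolvent hA I_im_ne φ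
  have key : ∀ ψ, embDual A (InnerProductSpace.toDual ℂ H φ) ψ
      = ⟪incl A u, shift A (conj Complex.I) ψ⟫_ℂ := fun ψ => by
    rw [← inner_shift_left hA, hφ]; rfl
  refine le_antisymm ?_ ?_
  · refine ContinuousLinearMap.opNorm_le_bound _ (norm_nonneg _) fun ψ => ?_
    rw [key, ← norm_shift_conj_I hA ψ]
    exact norm_inner_le_norm _ _
  · obtain ⟨ψ, hψ⟩ := shift_surjective hA (conj_im_ne I_im_ne) (incl A u)
    have h1 := (embDual A (InnerProductSpace.toDual ℂ H φ)).le_opNorm ψ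
    rw [key, ← norm_shift_conj_I hA ψ, hψ, inner_self_eq_norm_sq_to_K] at h1
    have h2 : ‖incl A u‖ ^ 2 ≤
        ‖embDual A (InnerProductSpace.toDual ℂ H φ)‖ * ‖incl A u‖ := by
      simpa using h1
    rcases (norm_nonneg (incl A u)).eq_or_lt with h | h
    · rw [← h]; exact norm_nonneg (embDual A (InnerProductSpace.toDual ℂ H φ))
    · exact le_of_mul_le_mul_right (by linarith [h2, sq ‖incl A u‖]) h

/-- The conjugate-linear map `C₊ : H₋ → H₊'`, the extension by continuity of
`I₊ C I₋⁻¹ : I₋(H) → I₊(H')`, where `C : H → H'` is `(C ψ)(φ) = ⟨ψ, φ⟩`. Its inverse is `C₋`, the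
extension by continuity of `I₋ C⁻¹ I₊⁻¹`. -/
def cPlus (hA : IsSelfAdjoint A) : HMinus hA ≃ₗᵢ⋆[ℂ] StrongDual ℂ (HPlus A) :=
  LinearEquiv.extendOfIsometry (Eₗ := HMinus hA) (Fₗ := StrongDual ℂ (HPlus A))
    (InnerProductSpace.toDual ℂ H).toLinearEquiv (embMinusₗ hA) (embDualₗ A)
    (embMinus_denseRange hA) (embDual_denseRange hA) (norm_embDual_toDual hA)

/-- The conjugate-linear map `C₋ : H₊' → H₋`. -/
def cMinus (hA : IsSelfAdjoint A) : StrongDual ℂ (HPlus A) ≃ₗᵢ⋆[ℂ] HMinus hA := (cPlus hA).symm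

/-- The pairing `(φ, ψ) = (C₊ φ)(ψ)` between `H₋` and `H₊`. -/
def pairing (hA : IsSelfAdjoint A) (φ : HMinus hA) (ψ : HPlus A) : ℂ := cPlus hA φ ψ

theorem pairing_embMinus (hA : IsSelfAdjoint A) (φ : H) (ψ : HPlus A) :
    pairing hA (embMinus hA φ) ψ = ⟪φ, incl A ψ⟫_ℂ := by
  have h : cPlus hA (embMinusₗ hA φ) =
      embDualₗ A ((InnerProductSpace.toDual ℂ H).toLinearEquiv φ) := by
    unfold cPlus
    rw [LinearEquiv.extendOfIsometry_eq]
  change cPlus hA (embMinusₗ hA φ) ψ = _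
  rw [h]
  rfl

/-- The operator `Ā : H → H₋`, the unique bounded extension of `I₋ A : D(A) ⊆ H → H₋`. -/
def aBar (hA : IsSelfAdjoint A) : H →L[ℂ] HMinus hA :=
  ((embMinus hA).comp (op A)).toLinearMap.extendOfNorm (incl A).toLinearMap

theorem norm_embMinus_op_le (hA : IsSelfAdjoint A) (φ : HPlus A) :
    ‖embMinus hA (op A φ)‖ ≤ 1 * ‖incl A φ‖ := by
  rw [norm_embMinus, one_mul]
  set w := resolvent hA I_im_ne (incl A φ) with hw
  have h1 : shift A Complex.I w = incl A φ := shift_resolvent hA I_im_ne _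
  have h2 : resolvent hA I_im_ne (op A φ) = Complex.I • w - φ := by
    have : op A φ = Complex.I • incl A φ - shift A Complex.I φ := by rw [shift_apply]; abel
    rw [this, map_sub, map_smul, resolvent_shift]
  have h3 : incl A (resolvent hA I_im_ne (op A φ)) = op A w := by
    rw [h2, map_sub, map_smul, ← h1, shift_apply]; abel
  rw [h3, ← h1, norm_shift_I hA]
  have h := hPlus_norm_sq A w
  exact abs_le_of_sq_le_sq' (by change ‖opₗ A w‖ ^ 2 ≤ _; nlinarith [sq_nonneg ‖inclₗ A w‖])
    (norm_nonneg _) |>.2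

/-- `Ā` extends `I₋ A`. -/
theorem aBar_incl (hA : IsSelfAdjoint A) (φ : HPlus A) :
    aBar hA (incl A φ) = embMinus hA (op A φ) :=
  LinearMap.extendOfNorm_eq (f := ((embMinus hA).comp (op A)).toLinearMap)
    (e := (incl A).toLinearMap) (incl_denseRange hA) ⟨1, norm_embMinus_op_le hA⟩ φ

/-! ### The boundary map `τ`, the operators `G(z)` and the decomposition `φ = φ₀ + G⋆ Q` -/

variable {𝔥 : Type*} [NormedAddCommGroup 𝔥] [InnerProductSpace ℂ 𝔥] [CompleteSpace 𝔥]

/-- The operator `G(z) = (τ R(z̄))* : 𝔥 → H`. -/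
def opG (hA : IsSelfAdjoint A) (τ : HPlus A →L[ℂ] 𝔥) {z : ℂ} (hz : z.im ≠ 0) : 𝔥 →L[ℂ] H :=
  ContinuousLinearMap.adjoint (τ.comp (resolvent hA (conj_im_ne hz)))

/-- `G⋆ = (G(z₀) + G(z̄₀)) / 2`. -/
def gStar (hA : IsSelfAdjoint A) (τ : HPlus A →L[ℂ] 𝔥) {z₀ : ℂ} (hz : z₀.im ≠ 0) : 𝔥 →L[ℂ] H :=
  (1 / 2 : ℂ) • (opG hA τ hz + opG hA τ (conj_im_ne hz))

/-- `G_⋄ = (G(z₀) - G(z̄₀)) / 2`. -/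
def gDiamond (hA : IsSelfAdjoint A) (τ : HPlus A →L[ℂ] 𝔥) {z₀ : ℂ} (hz : z₀.im ≠ 0) :
    𝔥 →L[ℂ] H :=
  (1 / 2 : ℂ) • (opG hA τ hz - opG hA τ (conj_im_ne hz))

theorem inner_opG_shift (hA : IsSelfAdjoint A) (τ : HPlus A →L[ℂ] 𝔥) {z : ℂ} (hz : z.im ≠ 0)
    (Q : 𝔥) (ψ : HPlus A) : ⟪opG hA τ hz Q, shift A (conj z) ψ⟫_ℂ = ⟪Q, τ ψ⟫_ℂ := by
  rw [opG, ContinuousLinearMap.adjoint_inner_left, ContinuousLinearMap.comp_apply, resolvent_shift]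

/-- The resolvent identity `G(z̄) - G(z) = (z - z̄) R(z̄) G(z)`. -/
theorem opG_conj (hA : IsSelfAdjoint A) (τ : HPlus A →L[ℂ] 𝔥) {z : ℂ} (hz : z.im ≠ 0) (Q : 𝔥) :
    opG hA τ (conj_im_ne hz) Q = opG hA τ hz Q
      + (z - conj z) • incl A (resolvent hA (conj_im_ne hz) (opG hA τ hz Q)) := by
  refine ext_inner_right ℂ fun v => ?_
  obtain ⟨ψ, rfl⟩ := shift_surjective hA hz v
  have h1 := inner_opG_shift hA τ (conj_im_ne hz) Q ψ
  rw [Complex.conj_conj] at h1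
  have h2 := inner_shift_left hA (conj z) (resolvent hA (conj_im_ne hz) (opG hA τ hz Q)) ψ
  rw [Complex.conj_conj, shift_resolvent] at h2
  have h3 := inner_opG_shift hA τ hz Q ψ
  rw [h1, inner_add_left, inner_smul_left, ← h2, ← h3, map_sub, Complex.conj_conj]
  simp only [shift_apply, inner_sub_right, inner_smul_right]
  ring

/-- If `G⋆ Q ∈ D(A)`, then `Q = 0`. -/
theorem eq_zero_of_gStar (hA : IsSelfAdjoint A) (τ : HPlus A →L[ℂ] 𝔥) (hτ : Function.Surjective τ)
    (hN : Dense (kerN τ : Set H)) {z₀ : ℂ} (hz : z₀.im ≠ 0) (Q : 𝔥) (φ : HPlus A)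
    (h : incl A φ = gStar hA τ hz Q) : Q = 0 := by
  set g := opG hA τ hz Q with hg
  set r := resolvent hA (conj_im_ne hz) g with hr
  have h1 : gStar hA τ hz Q = (1 / 2 : ℂ) • (g + opG hA τ (conj_im_ne hz) Q) := rfl
  have h2 : g = incl A (φ - ((z₀ - conj z₀) / 2) • r) := by
    rw [map_sub, map_smul, h, h1, opG_conj hA τ hz Q, ← hg, ← hr]
    module
  set χ := φ - ((z₀ - conj z₀) / 2) • r with hχ
  have h3 : shift A z₀ χ = 0 := by
    refine hN.eq_zero_of_inner_left ℂ ?_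
    rintro _ ⟨ψ, hψ, rfl⟩
    have h4 := inner_opG_shift hA τ hz Q ψ
    rw [← hg, h2, ← inner_shift_left hA, show τ ψ = 0 from hψ, inner_zero_right] at h4
    exact h4
  have h5 : g = 0 := by
    rw [h2, shift_injective hA hz (h3.trans (map_zero _).symm), map_zero]
  obtain ⟨ψ, hψ⟩ := hτ Q
  have h6 := inner_opG_shift hA τ hz Q ψ
  rw [← hg, h5, inner_zero_left, hψ] at h6
  exact inner_self_eq_zero.mp h6.symm

/-- The map `(φ₀, Q) ↦ φ₀ + G⋆ Q`. -/
def compose (hA : IsSelfAdjoint A) (τ : HPlus A →L[ℂ] 𝔥) {z₀ : ℂ} (hz : z₀.im ≠ 0) :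
    HPlus A × 𝔥 →ₗ[ℂ] H :=
  (incl A).toLinearMap.coprod (gStar hA τ hz).toLinearMap

theorem compose_injective (hA : IsSelfAdjoint A) (τ : HPlus A →L[ℂ] 𝔥)
    (hτ : Function.Surjective τ) (hN : Dense (kerN τ : Set H)) {z₀ : ℂ} (hz : z₀.im ≠ 0) :
    Function.Injective (compose hA τ hz) := by
  refine (injective_iff_map_eq_zero _).mpr fun p hp => ?_
  have h1 : incl A p.1 + gStar hA τ hz p.2 = 0 := hp
  have h2 : p.2 = 0 := eq_zero_of_gStar hA τ hτ hN hz p.2 (-p.1) (by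
    rw [map_neg]; exact neg_eq_of_add_eq_zero_right h1)
  rw [h2, map_zero, add_zero] at h1
  exact Prod.ext (incl_injective A (by rw [h1]; exact (map_zero _).symm)) h2

/-- The domain of `Ã`: all `φ = φ₀ + G⋆ Q` with `φ₀ ∈ D(A)` and `Q ∈ 𝔥`. -/
def tildeDomain (hA : IsSelfAdjoint A) (τ : HPlus A →L[ℂ] 𝔥) {z₀ : ℂ} (hz : z₀.im ≠ 0) :
    Submodule ℂ H :=
  LinearMap.range (compose hA τ hz)

/-- The isomorphism `(φ₀, Q) ↦ φ₀ + G⋆ Q` of `D(A) × 𝔥` with the domain of `Ã`. -/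
def composeEquiv (hA : IsSelfAdjoint A) (τ : HPlus A →L[ℂ] 𝔥) (hτ : Function.Surjective τ)
    (hN : Dense (kerN τ : Set H)) {z₀ : ℂ} (hz : z₀.im ≠ 0) :
    (HPlus A × 𝔥) ≃ₗ[ℂ] tildeDomain hA τ hz :=
  LinearEquiv.ofInjective (compose hA τ hz) (compose_injective hA τ hτ hN hz)

/-- The regular part `φ₀` of `φ = φ₀ + G⋆ Q_φ`. -/
def regPart (hA : IsSelfAdjoint A) (τ : HPlus A →L[ℂ] 𝔥) (hτ : Function.Surjective τ)
    (hN : Dense (kerN τ : Set H)) {z₀ : ℂ} (hz : z₀.im ≠ 0) :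
    tildeDomain hA τ hz →ₗ[ℂ] HPlus A :=
  LinearMap.fst ℂ (HPlus A) 𝔥 ∘ₗ (composeEquiv hA τ hτ hN hz).symm.toLinearMap

/-- The charge `Q_φ` of `φ = φ₀ + G⋆ Q_φ`. -/
def charge (hA : IsSelfAdjoint A) (τ : HPlus A →L[ℂ] 𝔥) (hτ : Function.Surjective τ)
    (hN : Dense (kerN τ : Set H)) {z₀ : ℂ} (hz : z₀.im ≠ 0) :
    tildeDomain hA τ hz →ₗ[ℂ] 𝔥 :=
  LinearMap.snd ℂ (HPlus A) 𝔥 ∘ₗ (composeEquiv hA τ hτ hN hz).symm.toLinearMap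

theorem regPart_add_charge (hA : IsSelfAdjoint A) (τ : HPlus A →L[ℂ] 𝔥)
    (hτ : Function.Surjective τ) (hN : Dense (kerN τ : Set H)) {z₀ : ℂ} (hz : z₀.im ≠ 0)
    (φ : tildeDomain hA τ hz) :
    incl A (regPart hA τ hτ hN hz φ) + gStar hA τ hz (charge hA τ hτ hN hz φ) = φ :=
  congrArg Subtype.val ((composeEquiv hA τ hτ hN hz).apply_symm_apply φ)

/-! ### The operators `T`, `Ã`, `A_Θ` and `T_Θ` -/

/-- The operator `τ* = C₋ τ' C_𝔥 : 𝔥 → H₋`, with `τ'` the adjoint of `τ` between the strong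
duals. -/
def tauStar (hA : IsSelfAdjoint A) (τ : HPlus A →L[ℂ] 𝔥) : 𝔥 →L[ℂ] HMinus hA :=
  ((cMinus hA : StrongDual ℂ (HPlus A) →L⋆[ℂ] HMinus hA).comp
    (ContinuousLinearMap.precomp ℂ τ)).comp
      (InnerProductSpace.toDual ℂ 𝔥 : 𝔥 →L⋆[ℂ] StrongDual ℂ 𝔥)

/-- The operator `T φ = τ* Q_φ`. -/
def opT (hA : IsSelfAdjoint A) (τ : HPlus A →L[ℂ] 𝔥) (hτ : Function.Surjective τ)
    (hN : Dense (kerN τ : Set H)) {z₀ : ℂ} (hz : z₀.im ≠ 0) : H →ₗ.[ℂ] HMinus hA where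
  domain := tildeDomain hA τ hz
  toFun := (tauStar hA τ).toLinearMap ∘ₗ charge hA τ hτ hN hz

/-- The operator `Ã = Ā + T`. -/
def aTilde (hA : IsSelfAdjoint A) (τ : HPlus A →L[ℂ] 𝔥) (hτ : Function.Surjective τ)
    (hN : Dense (kerN τ : Set H)) {z₀ : ℂ} (hz : z₀.im ≠ 0) : H →ₗ.[ℂ] HMinus hA :=
  (aBar hA).toLinearMap +ᵥ opT hA τ hτ hN hz

/-- The domain of `A_Θ`: all `φ = φ₀ + G⋆ Q` with `φ₀ ∈ D(A)`, `Q ∈ D(Θ)` and `τ φ₀ = Θ Q`. -/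
def thetaDomain (hA : IsSelfAdjoint A) (τ : HPlus A →L[ℂ] 𝔥) {z₀ : ℂ} (hz : z₀.im ≠ 0)
    (Θ : 𝔥 →ₗ.[ℂ] 𝔥) : Submodule ℂ H where
  carrier := {φ | ∃ (φ₀ : HPlus A) (Q : Θ.domain),
    φ = incl A φ₀ + gStar hA τ hz (Q : 𝔥) ∧ τ φ₀ = Θ Q}
  zero_mem' := ⟨0, 0, by simp, by simp⟩
  add_mem' := by
    rintro _ _ ⟨φ₀, Q, rfl, h1⟩ ⟨ψ₀, P, rfl, h2⟩
    refine ⟨φ₀ + ψ₀, Q + P, ?_, ?_⟩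
    · rw [Submodule.coe_add, map_add, map_add]; abel
    · rw [map_add, LinearPMap.map_add, h1, h2]
  smul_mem' := by
    rintro c _ ⟨φ₀, Q, rfl, h1⟩
    refine ⟨c • φ₀, c • Q, ?_, ?_⟩
    · rw [Submodule.coe_smul, map_smul, map_smul, smul_add]
    · rw [map_smul, LinearPMap.map_smul, h1]

theorem thetaDomain_le (hA : IsSelfAdjoint A) (τ : HPlus A →L[ℂ] 𝔥) {z₀ : ℂ} (hz : z₀.im ≠ 0)
    (Θ : 𝔥 →ₗ.[ℂ] 𝔥) : thetaDomain hA τ hz Θ ≤ tildeDomain hA τ hz := by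
  rintro _ ⟨φ₀, Q, rfl, -⟩
  exact ⟨(φ₀, Q), rfl⟩

/-- The operator `A_Θ φ = A φ₀ + Re(z₀) G⋆ Q_φ + i Im(z₀) G_⋄ Q_φ` on the domain `D(A_Θ)`. -/
def aTheta (hA : IsSelfAdjoint A) (τ : HPlus A →L[ℂ] 𝔥) (hτ : Function.Surjective τ)
    (hN : Dense (kerN τ : Set H)) {z₀ : ℂ} (hz : z₀.im ≠ 0) (Θ : 𝔥 →ₗ.[ℂ] 𝔥) :
    H →ₗ.[ℂ] H where
  domain := thetaDomain hA τ hz Θ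
  toFun := ((op A).toLinearMap ∘ₗ regPart hA τ hτ hN hz
    + ((z₀.re : ℂ) • gStar hA τ hz + (Complex.I * z₀.im) • gDiamond hA τ hz).toLinearMap
        ∘ₗ charge hA τ hτ hN hz) ∘ₗ Submodule.inclusion (thetaDomain_le hA τ hz Θ)

/-- The operator `T_Θ`, the restriction of `T` to `D(A_Θ)`. -/
def tTheta (hA : IsSelfAdjoint A) (τ : HPlus A →L[ℂ] 𝔥) (hτ : Function.Surjective τ)
    (hN : Dense (kerN τ : Set H)) {z₀ : ℂ} (hz : z₀.im ≠ 0) (Θ : 𝔥 →ₗ.[ℂ] 𝔥) :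
    H →ₗ.[ℂ] HMinus hA :=
  (opT hA τ hτ hN hz).domRestrict (thetaDomain hA τ hz Θ)

/-- `S` is the bounded, everywhere defined inverse of the operator `Θ`. -/
structure IsBoundedInverse (Θ : 𝔥 →ₗ.[ℂ] 𝔥) (S : 𝔥 →L[ℂ] 𝔥) : Prop where
  left_inv : ∀ Q : Θ.domain, S (Θ Q) = Q
  right_inv : ∀ q : 𝔥, ∃ Q : Θ.domain, (Q : 𝔥) = S q ∧ Θ Q = q

end AddPert
end

noncomputable section

namespace AddPert

/-! ### Functionals vanishing on the kernel of a surjection -/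

/-! Write `B` for `singOp`, the average of `z • G(z)` over `z = z₀, z̄₀`. The definition of `G(z)`
says `⟪G(z) Q, (-A + z̄) ψ⟫ = ⟪Q, τ ψ⟫`, which in `H₋` reads `Ā G(z) Q = I₋(z G(z) Q) - τ* Q`. The
singular term does not depend on `z`, so averaging gives `I₋ B Q = Ā G⋆ Q + τ* Q`
(`embMinus_singOp`). Hence `T` cancels exactly the part of `Ā φ` outside `H`, and `Ã (φ₀ + G⋆ Q) =
I₋(A φ₀ + B Q)`. All additive formulas follow from this, with `V_Θ = τ* Θ⁻¹ τ`.

Self-adjointness rests on `green_formula`: the failure of symmetry of `φ₀ + G⋆ Q ↦ A φ₀ + B Q` is a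
form in the boundary data `(Q, τ φ₀)` alone. The condition `τ φ₀ = Θ Q` makes it vanish, because `Θ`
is symmetric. Conversely, for `ψ` in the domain of the adjoint, testing on `N` produces a charge `P`
(`exists_inner_comp_of_vanish_ker`), self-adjointness of `A` puts `ψ - G⋆ P` in `D(A)`, and
self-adjointness of `Θ` yields the boundary condition. -/

/-- A continuous functional that vanishes on the kernel of a surjective bounded operator `τ` onto a
Hilbert space is of the form `⟪P, τ ·⟫`. -/
theorem exists_inner_comp_of_vanish_ker {E F : Type*} [NormedAddCommGroup E] [NormedSpace ℂ E]
    [CompleteSpace E] [NormedAddCommGroup F] [InnerProductSpace ℂ F] [CompleteSpace F]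
    (τ : E →L[ℂ] F) (hτ : Function.Surjective τ) (l : E →L[ℂ] ℂ)
    (hl : ∀ x, τ x = 0 → l x = 0) : ∃ P : F, ∀ x, l x = ⟪P, τ x⟫_ℂ := by
  -- The open mapping theorem gives a norm-controlled section `s` of `τ`. It need not be linear, but
  -- `l ∘ s` is, since `l x` depends only on `τ x`.
  obtain ⟨C, -, hC⟩ := τ.exists_preimage_norm_le hτ
  choose s hs hsn using hC
  have hcongr : ∀ x y, τ x = τ y → l x = l y := fun x y h => by
    rw [← sub_eq_zero, ← map_sub]
    exact hl _ (by rw [map_sub, h, sub_self])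
  let m : F →ₗ[ℂ] ℂ :=
    { toFun := fun q => l (s q)
      map_add' := fun p q => by
        rw [← map_add]
        exact hcongr _ _ (by rw [map_add, hs, hs, hs])
      map_smul' := fun c q => by
        rw [RingHom.id_apply, ← map_smul]
        exact hcongr _ _ (by rw [map_smul, hs, hs]) }
  let M : StrongDual ℂ F := m.mkContinuous (‖l‖ * C) fun q => by
    calc ‖l (s q)‖ ≤ ‖l‖ * ‖s q‖ := l.le_opNorm _
      _ ≤ ‖l‖ * (C * ‖q‖) := by gcongr; exact hsn q
      _ = _ := by ring
  refine ⟨(InnerProductSpace.toDual ℂ F).symm M, fun x => ?_⟩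
  rw [InnerProductSpace.toDual_symm_apply]
  exact hcongr _ _ (hs _).symm

variable {H : Type*} [NormedAddCommGroup H] [InnerProductSpace ℂ H] [CompleteSpace H]
  {A : H →ₗ.[ℂ] H}

/-! ### The pairing -/

theorem pairing_add (hA : IsSelfAdjoint A) (x y : HMinus hA) (ψ : HPlus A) :
    pairing hA (x + y) ψ = pairing hA x ψ + pairing hA y ψ := by
  simp only [pairing, map_add, add_apply]

theorem eq_of_pairing_eq (hA : IsSelfAdjoint A) {x y : HMinus hA}
    (h : ∀ ψ, pairing hA x ψ = pairing hA y ψ) : x = y :=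
  (cPlus hA).injective (ContinuousLinearMap.ext h)

theorem continuous_pairing (hA : IsSelfAdjoint A) (ψ : HPlus A) :
    Continuous fun x => pairing hA x ψ :=
  (ContinuousLinearMap.apply ℂ ℂ ψ).continuous.comp (cPlus hA).continuous

/-- Both sides are continuous in `x` and agree on the dense subspace `D(A)` by symmetry of `A`. So
`Ā` is the dual of `A : H₊ → H`. -/
theorem pairing_aBar (hA : IsSelfAdjoint A) (x : H) (ψ : HPlus A) :
    pairing hA (aBar hA x) ψ = ⟪x, op A ψ⟫_ℂ := by
  have h1 : Continuous fun x => pairing hA (aBar hA x) ψ :=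
    (continuous_pairing hA ψ).comp (aBar hA).continuous
  have h2 : Continuous fun x => ⟪x, op A ψ⟫_ℂ := by fun_prop
  refine congrFun ((incl_denseRange hA).equalizer h1 h2 (funext fun φ => ?_)) x
  simp only [Function.comp_apply]
  rw [aBar_incl, pairing_embMinus, op_symm hA]

variable {𝔥 : Type*} [NormedAddCommGroup 𝔥] [InnerProductSpace ℂ 𝔥] [CompleteSpace 𝔥]

theorem pairing_tauStar (hA : IsSelfAdjoint A) (τ : HPlus A →L[ℂ] 𝔥) (Q : 𝔥) (ψ : HPlus A) :
    pairing hA (tauStar hA τ Q) ψ = ⟪Q, τ ψ⟫_ℂ := by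
  change cPlus hA ((cPlus hA).symm _) ψ = _
  rw [LinearIsometryEquiv.apply_symm_apply]
  rfl

/-! ### The singular part of `A_Θ` -/

/-- The operator `Re(z₀) G⋆ + i Im(z₀) G_⋄`, the action of `A_Θ` on the singular part. -/
def singOp (hA : IsSelfAdjoint A) (τ : HPlus A →L[ℂ] 𝔥) {z₀ : ℂ} (hz : z₀.im ≠ 0) : 𝔥 →L[ℂ] H :=
  (z₀.re : ℂ) • gStar hA τ hz + (Complex.I * z₀.im) • gDiamond hA τ hz

/-- In this form the operator is the average of `z • G(z)` over `z₀` and its conjugate, so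
identities for a single `G(z)` can be averaged. -/
theorem singOp_apply (hA : IsSelfAdjoint A) (τ : HPlus A →L[ℂ] 𝔥) {z₀ : ℂ} (hz : z₀.im ≠ 0)
    (Q : 𝔥) : singOp hA τ hz Q =
      (1 / 2 : ℂ) • (z₀ • opG hA τ hz Q + conj z₀ • opG hA τ (conj_im_ne hz) Q) := by
  have h1 : (z₀.re : ℂ) = (z₀ + conj z₀) / 2 := Complex.re_eq_add_conj z₀
  have h2 : Complex.I * z₀.im = (z₀ - conj z₀) / 2 := by
    rw [Complex.sub_conj]; push_cast; ring
  simp only [singOp, gStar, gDiamond, h1, h2, add_apply,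
    sub_apply, smul_apply]
  module

/-- The weak form of `(-Ā + z) G(z) = τ*`. -/
theorem inner_opG_op (hA : IsSelfAdjoint A) (τ : HPlus A →L[ℂ] 𝔥) {z : ℂ} (hz : z.im ≠ 0)
    (Q : 𝔥) (ψ : HPlus A) :
    ⟪opG hA τ hz Q, op A ψ⟫_ℂ = ⟪z • opG hA τ hz Q, incl A ψ⟫_ℂ - ⟪Q, τ ψ⟫_ℂ := by
  rw [← inner_opG_shift hA τ hz, shift_apply, inner_sub_right, inner_smul_right, inner_smul_left]
  ring

/-- The boundary term `⟪Q, τ ψ⟫` is the same at `z₀` and `z̄₀`, so it survives the averaging with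
coefficient one. -/
theorem inner_gStar_op (hA : IsSelfAdjoint A) (τ : HPlus A →L[ℂ] 𝔥) {z₀ : ℂ} (hz : z₀.im ≠ 0)
    (Q : 𝔥) (ψ : HPlus A) :
    ⟪gStar hA τ hz Q, op A ψ⟫_ℂ = ⟪singOp hA τ hz Q, incl A ψ⟫_ℂ - ⟪Q, τ ψ⟫_ℂ := by
  have h1 := inner_opG_op hA τ hz Q ψ
  have h2 := inner_opG_op hA τ (conj_im_ne hz) Q ψ
  have h3 : gStar hA τ hz Q = (1 / 2 : ℂ) • (opG hA τ hz Q + opG hA τ (conj_im_ne hz) Q) := rfl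
  rw [singOp_apply, h3, inner_smul_left, inner_smul_left, inner_add_left, inner_add_left, h1, h2]
  simp only [map_div₀, map_one, map_ofNat]
  ring

/-- With `r = R(z̄₀) G(z₀) Q ∈ D(A)` one has `G⋆ Q = (-A + Re z₀) r` and
`Re(z₀) G⋆ Q + i Im(z₀) G_⋄ Q = Re(z₀) G⋆ Q + Im(z₀)² r`. -/
theorem exists_gStar_singOp (hA : IsSelfAdjoint A) (τ : HPlus A →L[ℂ] 𝔥) {z₀ : ℂ}
    (hz : z₀.im ≠ 0) (Q : 𝔥) : ∃ r : HPlus A, gStar hA τ hz Q = shift A z₀.re r ∧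
      singOp hA τ hz Q = (z₀.re : ℂ) • gStar hA τ hz Q + ((z₀.im : ℂ) ^ 2) • incl A r := by
  set r := resolvent hA (conj_im_ne hz) (opG hA τ hz Q) with hr
  have h1 : shift A (conj z₀) r = opG hA τ hz Q := shift_resolvent hA _ _
  have h2 := opG_conj hA τ hz Q
  have h3 : gStar hA τ hz Q = (1 / 2 : ℂ) • (opG hA τ hz Q + opG hA τ (conj_im_ne hz) Q) := rfl
  have h4 : gDiamond hA τ hz Q = (1 / 2 : ℂ) • (opG hA τ hz Q - opG hA τ (conj_im_ne hz) Q) := rfl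
  have hre : (z₀.re : ℂ) = (z₀ + conj z₀) / 2 := Complex.re_eq_add_conj z₀
  refine ⟨r, ?_, ?_⟩
  -- By the resolvent identity, `G⋆ Q` is `G(z₀) Q = (-A + z̄₀) r` plus `½ (z₀ - z̄₀) r`, which
  -- moves the spectral parameter from `z̄₀` to `Re z₀`.
  · rw [h3, h2, ← hr, ← h1, shift_apply, shift_apply, hre]
    module
  · change (z₀.re : ℂ) • gStar hA τ hz Q + (Complex.I * z₀.im) • gDiamond hA τ hz Q = _
    have h5 : gDiamond hA τ hz Q = (-(Complex.I * z₀.im)) • incl A r := by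
      rw [h4, h2, ← hr, Complex.sub_conj]
      push_cast
      module
    rw [h5, smul_smul]
    congr 2
    linear_combination (-(z₀.im : ℂ) ^ 2) * Complex.I_sq

/-- Written through `r` and `s`, the coefficients are real, and what remains is the symmetry of `-A
+ Re z₀` on `D(A)`. This is why `A_Θ` needs no correction term quadratic in the charges. -/
theorem inner_singOp_gStar (hA : IsSelfAdjoint A) (τ : HPlus A →L[ℂ] 𝔥) {z₀ : ℂ}
    (hz : z₀.im ≠ 0) (Q P : 𝔥) :
    ⟪singOp hA τ hz Q, gStar hA τ hz P⟫_ℂ = ⟪gStar hA τ hz Q, singOp hA τ hz P⟫_ℂ := by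
  obtain ⟨r, h1, h2⟩ := exists_gStar_singOp hA τ hz Q
  obtain ⟨s, h3, h4⟩ := exists_gStar_singOp hA τ hz P
  have h5 := inner_shift_left hA (z₀.re : ℂ) r s
  rw [Complex.conj_ofReal, ← h1, ← h3] at h5
  rw [h2, h4]
  simp only [inner_add_left, inner_add_right, inner_smul_left, inner_smul_right, map_pow,
    Complex.conj_ofReal, h5]

/-- Green's formula for the operator `φ₀ + G⋆ Q ↦ A φ₀ + Re(z₀) G⋆ Q + i Im(z₀) G_⋄ Q`. -/
theorem green_formula (hA : IsSelfAdjoint A) (τ : HPlus A →L[ℂ] 𝔥) {z₀ : ℂ} (hz : z₀.im ≠ 0)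
    (φ₀ ψ₀ : HPlus A) (Q P : 𝔥) :
    ⟪op A φ₀ + singOp hA τ hz Q, incl A ψ₀ + gStar hA τ hz P⟫_ℂ
      - ⟪incl A φ₀ + gStar hA τ hz Q, op A ψ₀ + singOp hA τ hz P⟫_ℂ
      = ⟪Q, τ ψ₀⟫_ℂ - ⟪τ φ₀, P⟫_ℂ := by
  have h1 := inner_gStar_op hA τ hz Q ψ₀
  have h2 := congrArg conj (inner_gStar_op hA τ hz P φ₀)
  simp only [map_sub, inner_conj_symm] at h2
  -- The regular-regular and singular-singular terms cancel by symmetry; each mixed pair leaves one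
  -- boundary term.
  simp only [inner_add_left, inner_add_right, op_symm hA φ₀ ψ₀, inner_singOp_gStar hA τ hz Q P, h1,
    h2]
  ring

/-- This is `inner_gStar_op` read in `H₋`, where elements are separated by the pairing with `H₊`. -/
theorem embMinus_singOp (hA : IsSelfAdjoint A) (τ : HPlus A →L[ℂ] 𝔥) {z₀ : ℂ} (hz : z₀.im ≠ 0)
    (Q : 𝔥) :
    embMinus hA (singOp hA τ hz Q) = aBar hA (gStar hA τ hz Q) + tauStar hA τ Q := by
  refine eq_of_pairing_eq hA fun ψ => ?_
  rw [pairing_add, pairing_embMinus, pairing_aBar, pairing_tauStar, inner_gStar_op]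
  ring

/-! ### The extensions `A_Θ`: boundary condition, self-adjointness and additive form -/

section Extension

variable (hA : IsSelfAdjoint A) (τ : HPlus A →L[ℂ] 𝔥) (hτ : Function.Surjective τ)
  (hN : Dense (kerN τ : Set H)) {z₀ : ℂ} (hz : z₀.im ≠ 0)

theorem regPart_eq_and_charge_eq (φ : tildeDomain hA τ hz) (φ₀ : HPlus A) (Q : 𝔥)
    (h : (φ : H) = incl A φ₀ + gStar hA τ hz Q) :
    regPart hA τ hτ hN hz φ = φ₀ ∧ charge hA τ hτ hN hz φ = Q := by
  have h1 : φ = composeEquiv hA τ hτ hN hz (φ₀, Q) := Subtype.ext h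
  have h2 : (composeEquiv hA τ hτ hN hz).symm φ = (φ₀, Q) := by
    rw [h1, LinearEquiv.symm_apply_apply]
  exact ⟨congrArg Prod.fst h2, congrArg Prod.snd h2⟩

theorem mem_thetaDomain_iff (Θ : 𝔥 →ₗ.[ℂ] 𝔥) (φ : tildeDomain hA τ hz) :
    (φ : H) ∈ thetaDomain hA τ hz Θ ↔ ∃ Q : Θ.domain, (Q : 𝔥) = charge hA τ hτ hN hz φ ∧
      τ (regPart hA τ hτ hN hz φ) = Θ Q := by
  constructor
  · rintro ⟨φ₀, Q, h1, h2⟩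
    obtain ⟨h3, h4⟩ := regPart_eq_and_charge_eq hA τ hτ hN hz φ φ₀ Q h1
    exact ⟨Q, h4.symm, by rw [h3, h2]⟩
  · rintro ⟨Q, h1, h2⟩
    exact ⟨_, Q, by rw [h1, regPart_add_charge], h2⟩

/-- This exhibits the vector of `H` that represents `Ã φ`. -/
theorem embMinus_op_add_singOp (φ : tildeDomain hA τ hz) :
    embMinus hA (op A (regPart hA τ hτ hN hz φ) + singOp hA τ hz (charge hA τ hτ hN hz φ))
      = aBar hA φ + tauStar hA τ (charge hA τ hτ hN hz φ) := by
  rw [map_add, embMinus_singOp, ← aBar_incl, ← add_assoc, ← map_add, regPart_add_charge]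

/-- Uniqueness of the decomposition lets the value be computed from any decomposition at hand. -/
theorem aTheta_apply (Θ : 𝔥 →ₗ.[ℂ] 𝔥) (φ : (aTheta hA τ hτ hN hz Θ).domain) (φ₀ : HPlus A)
    (Q : 𝔥) (h : (φ : H) = incl A φ₀ + gStar hA τ hz Q) :
    aTheta hA τ hτ hN hz Θ φ = op A φ₀ + singOp hA τ hz Q := by
  obtain ⟨h1, h2⟩ := regPart_eq_and_charge_eq hA τ hτ hN hz
    (Submodule.inclusion (thetaDomain_le hA τ hz Θ) φ) φ₀ Q h
  change op A (regPart hA τ hτ hN hz (Submodule.inclusion (thetaDomain_le hA τ hz Θ) φ))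
    + singOp hA τ hz (charge hA τ hτ hN hz
      (Submodule.inclusion (thetaDomain_le hA τ hz Θ) φ)) = _
  rw [h1, h2]

theorem embMinus_aTheta (Θ : 𝔥 →ₗ.[ℂ] 𝔥) (φ : (aTheta hA τ hτ hN hz Θ).domain)
    (φ' : tildeDomain hA τ hz) (h : (φ' : H) = φ) :
    embMinus hA (aTheta hA τ hτ hN hz Θ φ)
      = aBar hA φ + tauStar hA τ (charge hA τ hτ hN hz φ') := by
  rw [aTheta_apply hA τ hτ hN hz Θ φ _ _ (h.symm.trans (regPart_add_charge hA τ hτ hN hz φ').symm),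
    embMinus_op_add_singOp, h]

theorem kerN_le_thetaDomain (Θ : 𝔥 →ₗ.[ℂ] 𝔥) : kerN τ ≤ thetaDomain hA τ hz Θ := by
  rintro _ ⟨φ₀, h, rfl⟩
  refine ⟨φ₀, 0, ?_, ?_⟩
  · rw [Submodule.coe_zero, map_zero, add_zero]; rfl
  · rw [LinearPMap.map_zero]; exact h

theorem domRestrict_kerN_le_aTheta (Θ : 𝔥 →ₗ.[ℂ] 𝔥) :
    A.domRestrict (kerN τ) ≤ aTheta hA τ hτ hN hz Θ := by
  -- The domain of `domRestrict` is an intersection: `hx.1` is membership in `N`, and `x.2.2` below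
  -- is membership in `D(A)`.
  refine ⟨fun x hx => kerN_le_thetaDomain hA τ hz Θ hx.1, fun x y hxy => ?_⟩
  have h1 : (y : H) = incl A (⟨x, x.2.2⟩ : A.domain) + gStar hA τ hz 0 := by
    rw [map_zero, add_zero, ← hxy]; rfl
  rw [aTheta_apply hA τ hτ hN hz Θ y _ 0 h1, map_zero, add_zero]
  exact LinearPMap.domRestrict_apply rfl

/-- Under the boundary condition the right side of Green's formula is `⟪Q, Θ P⟫ - ⟪Θ Q, P⟫`, which
is zero. -/
theorem aTheta_isFormalAdjoint {Θ : 𝔥 →ₗ.[ℂ] 𝔥} (hΘ : IsSelfAdjoint Θ) :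
    (aTheta hA τ hτ hN hz Θ).IsFormalAdjoint (aTheta hA τ hτ hN hz Θ) := by
  intro φ ψ
  obtain ⟨φ₀, Q, h1, h2⟩ := φ.2
  obtain ⟨ψ₀, P, h3, h4⟩ := ψ.2
  rw [aTheta_apply hA τ hτ hN hz Θ φ _ _ h1, aTheta_apply hA τ hτ hN hz Θ ψ _ _ h3, h1, h3,
    ← sub_eq_zero, green_formula, h2, h4, sub_eq_zero]
  exact (op_symm hΘ Q P).symm

theorem aTheta_isSelfAdjoint {Θ : 𝔥 →ₗ.[ℂ] 𝔥} (hΘ : IsSelfAdjoint Θ) :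
    IsSelfAdjoint (aTheta hA τ hτ hN hz Θ) := by
  have := hPlus_complete hA
  have hd : Dense ((aTheta hA τ hτ hN hz Θ).domain : Set H) :=
    hN.mono (kerN_le_thetaDomain hA τ hz Θ)
  refine LinearPMap.isSelfAdjoint_def.mpr (le_antisymm ?_
    ((aTheta_isFormalAdjoint hA τ hτ hN hz hΘ).le_adjoint hd))
  have key : ∀ ψ : (aTheta hA τ hτ hN hz Θ).adjoint.domain, ∃ (ψ₀ : HPlus A) (P : Θ.domain),
      (ψ : H) = incl A ψ₀ + gStar hA τ hz (P : 𝔥) ∧ τ ψ₀ = Θ P ∧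
        (aTheta hA τ hτ hN hz Θ).adjoint ψ = op A ψ₀ + singOp hA τ hz (P : 𝔥) := by
    intro ψ
    set w := (aTheta hA τ hτ hN hz Θ).adjoint ψ with hw
    have h1 : ∀ (φ₀ : HPlus A) (Q : Θ.domain), τ φ₀ = Θ Q →
        ⟪w, incl A φ₀ + gStar hA τ hz (Q : 𝔥)⟫_ℂ
          = ⟪(ψ : H), op A φ₀ + singOp hA τ hz (Q : 𝔥)⟫_ℂ := fun φ₀ Q h => by
      let φ : (aTheta hA τ hτ hN hz Θ).domain :=
        ⟨incl A φ₀ + gStar hA τ hz (Q : 𝔥), φ₀, Q, rfl, h⟩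
      rw [← aTheta_apply hA τ hτ hN hz Θ φ φ₀ Q rfl]
      exact LinearPMap.adjoint_isFormalAdjoint hd ψ φ
    -- The charge of `ψ`: on `N`, where the test vectors have charge `0`, the functional `φ₀ ↦ ⟪w,
    -- φ₀⟫ - ⟪ψ, A φ₀⟫` vanishes, so it factors through `τ`.
    obtain ⟨P, hP⟩ := exists_inner_comp_of_vanish_ker τ hτ
      ((innerSL ℂ w).comp (incl A) - (innerSL ℂ (ψ : H)).comp (op A)) fun φ₀ h => by
        have h2 := h1 φ₀ 0 (by rw [h, LinearPMap.map_zero])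
        rw [Submodule.coe_zero, map_zero, map_zero, add_zero, add_zero] at h2
        exact sub_eq_zero.mpr h2
    -- Subtracting `G⋆ P` removes the term `⟪P, τ φ₀⟫`, so the remainder lies in the domain of the
    -- adjoint of `A`, which is `A`.
    obtain ⟨ψ₀, h3, h4⟩ := exists_hPlus hA ((ψ : H) - gStar hA τ hz P) (w - singOp hA τ hz P)
      fun φ₀ => by
        have h5 : ⟪w, incl A φ₀⟫_ℂ - ⟪(ψ : H), op A φ₀⟫_ℂ = ⟪P, τ φ₀⟫_ℂ := hP φ₀
        rw [inner_sub_left, inner_sub_left, inner_gStar_op]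
        linear_combination h5
    have h6 : (ψ : H) = incl A ψ₀ + gStar hA τ hz P := by rw [h3, sub_add_cancel]
    have h7 : w = op A ψ₀ + singOp hA τ hz P := by rw [h4, sub_add_cancel]
    -- Surjectivity of `τ` supplies a test vector for every `Q ∈ D(Θ)`. Green's formula then gives
    -- `⟪τ ψ₀, Q⟫ = ⟪P, Θ Q⟫`, so `P ∈ D(Θ)` and `Θ P = τ ψ₀`.
    obtain ⟨P', h8, h9⟩ := exists_hPlus hΘ P (τ ψ₀) fun Q => by
      obtain ⟨φ₀, hφ₀⟩ := hτ (op Θ Q)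
      have h10 := sub_eq_zero.mpr (h1 φ₀ Q hφ₀)
      rw [h6, h7, green_formula, hφ₀, sub_eq_zero] at h10
      exact h10.symm
    subst h8
    exact ⟨ψ₀, P', h6, h9.symm, h7⟩
  refine ⟨fun x hx => ?_, fun x y hxy => ?_⟩
  · obtain ⟨ψ₀, P, h1, h2, -⟩ := key ⟨x, hx⟩
    exact ⟨ψ₀, P, h1, h2⟩
  · obtain ⟨ψ₀, P, h1, -, h3⟩ := key x
    rw [h3, aTheta_apply hA τ hτ hN hz Θ y ψ₀ P (hxy.symm.trans h1)]

theorem aTilde_domRestrict_eq (Θ : 𝔥 →ₗ.[ℂ] 𝔥) :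
    (aTilde hA τ hτ hN hz).domRestrict (aTheta hA τ hτ hN hz Θ).domain
      = (embMinus hA).toLinearMap.compPMap (aTheta hA τ hτ hN hz Θ) := by
  refine LinearPMap.ext (inf_eq_left.mpr (thetaDomain_le hA τ hz Θ)) fun x h1 h2 => ?_
  have h3 : (aTilde hA τ hτ hN hz).domRestrict (aTheta hA τ hτ hN hz Θ).domain ⟨x, h1⟩
      = aTilde hA τ hτ hN hz ⟨x, h1.2⟩ := LinearPMap.domRestrict_apply rfl
  exact h3.trans (embMinus_aTheta hA τ hτ hN hz Θ ⟨x, h2⟩ ⟨x, h1.2⟩ rfl).symm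

theorem embMinus_aTheta_eq_vadd (Θ : 𝔥 →ₗ.[ℂ] 𝔥) :
    (embMinus hA).toLinearMap.compPMap (aTheta hA τ hτ hN hz Θ)
      = (aBar hA).toLinearMap +ᵥ tTheta hA τ hτ hN hz Θ := by
  refine LinearPMap.ext (inf_eq_left.mpr (thetaDomain_le hA τ hz Θ)).symm fun x h1 h2 => ?_
  have h3 : tTheta hA τ hτ hN hz Θ ⟨x, h2⟩ = opT hA τ hτ hN hz ⟨x, h2.2⟩ :=
    LinearPMap.domRestrict_apply rfl
  rw [LinearPMap.vadd_apply, h3]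
  exact embMinus_aTheta hA τ hτ hN hz Θ ⟨x, h1⟩ ⟨x, h2.2⟩ rfl

end Extension

end AddPert
end

theorem theorem3p4
    {H : Type*} [NormedAddCommGroup H] [InnerProductSpace ℂ H] [CompleteSpace H]
    {𝔥 : Type*} [NormedAddCommGroup 𝔥] [InnerProductSpace ℂ 𝔥] [CompleteSpace 𝔥]
    (A : H →ₗ.[ℂ] H) (hA : IsSelfAdjoint A)
    (τ : AddPert.HPlus A →L[ℂ] 𝔥) (hτ : Function.Surjective τ)
    (hN : Dense (AddPert.kerN τ : Set H))
    (z₀ : ℂ) (hz : z₀.im ≠ 0) :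
    -- `Ã` is `H`-valued
    (∀ φ : (AddPert.aTilde hA τ hτ hN hz).domain,
      ∃ ψ : H, AddPert.embMinus hA ψ = AddPert.aTilde hA τ hτ hN hz φ) ∧
    ∀ Θ : 𝔥 →ₗ.[ℂ] 𝔥, IsSelfAdjoint Θ →
      -- `A_Θ` is a self-adjoint extension of the restriction of `A` to `N`
      IsSelfAdjoint (AddPert.aTheta hA τ hτ hN hz Θ) ∧
      A.domRestrict (AddPert.kerN τ) ≤ AddPert.aTheta hA τ hτ hN hz Θ ∧
      -- within `D(Ã)`, the domain of `A_Θ` is given by the boundary condition `τ φ₀ = Θ Q_φ`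
      (∀ φ : AddPert.tildeDomain hA τ hz,
        (φ : H) ∈ (AddPert.aTheta hA τ hτ hN hz Θ).domain ↔
          ∃ Q : Θ.domain, (Q : 𝔥) = AddPert.charge hA τ hτ hN hz φ ∧
            τ (AddPert.regPart hA τ hτ hN hz φ) = Θ Q) ∧
      -- the restriction of `Ã` to `D(A_Θ)` is `A_Θ`
      (AddPert.aTilde hA τ hτ hN hz).domRestrict (AddPert.aTheta hA τ hτ hN hz Θ).domain =
        (AddPert.embMinus hA).toLinearMap.compPMap (AddPert.aTheta hA τ hτ hN hz Θ) ∧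
      -- `A_Θ = Ā + T_Θ`
      (AddPert.embMinus hA).toLinearMap.compPMap (AddPert.aTheta hA τ hτ hN hz Θ) =
        (AddPert.aBar hA).toLinearMap +ᵥ AddPert.tTheta hA τ hτ hN hz Θ ∧
      -- if `Θ` has a bounded inverse `S`, then `A_Θ φ = Ā φ + V_Θ φ₀`
      (∀ S : 𝔥 →L[ℂ] 𝔥, AddPert.IsBoundedInverse Θ S →
        ∃ V : AddPert.HPlus A →L[ℂ] AddPert.HMinus hA,
          (∀ φ₁ φ₂ : AddPert.HPlus A,
            AddPert.pairing hA (V φ₁) φ₂ = ⟪S (τ φ₁), τ φ₂⟫_ℂ) ∧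
          ∀ (φ : (AddPert.aTheta hA τ hτ hN hz Θ).domain) (φ' : AddPert.tildeDomain hA τ hz),
            (φ' : H) = φ →
              AddPert.embMinus hA (AddPert.aTheta hA τ hτ hN hz Θ φ) =
                AddPert.aBar hA φ + V (AddPert.regPart hA τ hτ hN hz φ')) := by
  refine ⟨fun φ => ⟨_, AddPert.embMinus_op_add_singOp hA τ hτ hN hz φ⟩, fun Θ hΘ =>
    ⟨AddPert.aTheta_isSelfAdjoint hA τ hτ hN hz hΘ,
      AddPert.domRestrict_kerN_le_aTheta hA τ hτ hN hz Θ,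
      AddPert.mem_thetaDomain_iff hA τ hτ hN hz Θ,
      AddPert.aTilde_domRestrict_eq hA τ hτ hN hz Θ,
      AddPert.embMinus_aTheta_eq_vadd hA τ hτ hN hz Θ,
      -- `V_Θ = τ* S τ`; the boundary condition gives `S τ φ₀ = Q_φ`, hence `V_Θ φ₀ = τ* Q_φ = T φ`.
      fun S hS => ⟨(AddPert.tauStar hA τ).comp (S.comp τ),
        fun φ₁ φ₂ => AddPert.pairing_tauStar hA τ _ φ₂, fun φ φ' h => ?_⟩⟩⟩
  obtain ⟨Q, h1, h2⟩ := (AddPert.mem_thetaDomain_iff hA τ hτ hN hz Θ φ').mp (h ▸ φ.2)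
  have h3 : S (τ (AddPert.regPart hA τ hτ hN hz φ')) = AddPert.charge hA τ hτ hN hz φ' := by
    rw [h2, hS.left_inv, h1]
  rw [AddPert.embMinus_aTheta hA τ hτ hN hz Θ φ φ' h, ← h3]
  rfl
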